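/- Let $A$ and $B$ be $n\times n$ complex matrices. Write $X_A(M)=AM$ and $\Delta_B(M)=B\circ M$ (entrywise product) for the corresponding linear operators on $n\times n$ complex matrices. The pair $(A,B)$ is a *one-sided Jones pair* if $X_A$ and $\Delta_B$ are invertible and $X_A\Delta_BX_A=\Delta_BX_A\Delta_B$; it is a *Jones pair* if $(A,B)$ and $(A,B^T)$ are both one-sided Jones pairs, and an *invertible Jones pair* if moreover every entry of $A$ is nonzero and $B$ is invertible. For a matrix $U$ with no zero entry let $U^{(-)}$ be its entrywise inverse, and let its Nomura algebra $\mathcal N_U$ be the set of all complex matrices $M$ for which every vector $Ue_i\circ U^{(-)}e_j$ is an eigenvector. Suppose that $(A,B)$ is an invertible Jones pair and that $A$ is symmetric, and put $$W=\begin{pmatrix}A^T&-A^T\\ (B^{(-)})^T&(B^{(-)})^T\end{pmatrix}.$$ Let $\pi$ be the partition of $\{1,\dots,2n\}$ into the cells $C_i=\{i,n+i\}$, $i=1,\dots,n$, and let $S$ be its $2n\times n$ characteristic matrix ($S_{h,k}=1$ if $h\in C_k$, and $0$ otherwise). Then $\pi$ is equitable relative to $\mathcal N_{W^T}$, that is,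 for each $M\in\mathcal N_{W^T}$ there is an $n\times n$ matrix $B_M$ (necessarily unique) with $MS=SB_M$; and the quotient of $\mathcal N_{W^T}$ with respect to $\pi$ is $\mathcal N_A$: $$\{B_M : M\in\mathcal N_{W^T}\}=\mathcal N_A.$$ -/

import Mathlib

open scoped Matrix

namespace JonesPair

variable {ι κ : Type*}

/-- The operator `X_A : M ↦ A M` on complex square matrices. -/
def X [Fintype ι] [DecidableEq ι] (A : Matrix ι ι ℂ) :
    Module.End ℂ (Matrix ι ι ℂ) :=
  LinearMap.mulLeft ℂ A

/-- The operator `Δ_B : M ↦ B ∘ M` (entrywise product) on complex square matrices. -/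
def Δ (B : Matrix ι ι ℂ) : Module.End ℂ (Matrix ι ι ℂ) where
  toFun M := B ⊙ M
  map_add' M N := Matrix.hadamard_add B M N
  map_smul' c M := Matrix.hadamard_smul B M c

/-- `A` is Schur invertible: no entry vanishes. -/
def IsSchurInvertible (A : Matrix ι κ ℂ) : Prop :=
  ∀ i j, A i j ≠ 0

/-- The Schur inverse `A⁽⁻⁾`, the entrywise inverse. -/
noncomputable def schurInv (A : Matrix ι κ ℂ) : Matrix ι κ ℂ :=
  Matrix.of fun i j => (A i j)⁻¹

/-- One-sided Jones pair: `X_A` and `Δ_B` are invertible operators and satisfy the braid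
relation `X_A Δ_B X_A = Δ_B X_A Δ_B`. -/
structure IsOneSidedJonesPair [Fintype ι] [DecidableEq ι] (A B : Matrix ι ι ℂ) : Prop where
  isUnit_X : IsUnit (X A)
  isUnit_Δ : IsUnit (Δ B)
  braid : X A * Δ B * X A = Δ B * X A * Δ B

/-- Jones pair: both `(A, B)` and `(A, Bᵀ)` are one-sided Jones pairs. -/
structure IsJonesPair [Fintype ι] [DecidableEq ι] (A B : Matrix ι ι ℂ) : Prop where
  left : IsOneSidedJonesPair A B
  right : IsOneSidedJonesPair A Bᵀ

/-- Invertible Jones pair: moreover `A` is Schur invertible and `B` is invertible. -/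
structure IsInvertibleJonesPair [Fintype ι] [DecidableEq ι] (A B : Matrix ι ι ℂ) : Prop where
  isJonesPair : IsJonesPair A B
  isSchurInvertible : IsSchurInvertible A
  isUnit : IsUnit B

/-- `N_{A,B}`: the matrices that have every vector `A e_i ∘ B e_j` as an eigenvector. -/
def nomuraPair [Fintype ι] (A B : Matrix ι κ ℂ) : Set (Matrix ι ι ℂ) :=
  {M | ∀ i j, ∃ c : ℂ, M *ᵥ (A.col i * B.col j) = c • (A.col i * B.col j)}

/-- The Nomura algebra `N_A` of a Schur invertible matrix `A`: the matrices that have every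
vector `A e_i ∘ A⁽⁻⁾ e_j` as an eigenvector. (These vectors have no zero entry.) -/
noncomputable def nomura [Fintype ι] (A : Matrix ι ι ℂ) : Set (Matrix ι ι ℂ) :=
  nomuraPair A (schurInv A)

/-- The matrix `W` with block rows `(Aᵀ, -Aᵀ)` and `(B⁽⁻⁾ᵀ, B⁽⁻⁾ᵀ)`. -/
noncomputable def matW (A B : Matrix ι ι ℂ) : Matrix (ι ⊕ ι) (ι ⊕ ι) ℂ :=
  Matrix.fromBlocks Aᵀ (-Aᵀ) (schurInv B)ᵀ (schurInv B)ᵀ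

/-- The characteristic matrix of a partition with cells `s k`: the entry at `(i, k)` is `1` if
`i` lies in the cell `s k`, and `0` otherwise. -/
noncomputable def charMatrix {s : κ → Set ι} (_π : IndexedPartition s) : Matrix ι κ ℂ :=
  Matrix.of fun i k => (s k).indicator 1 i

/-- `Q` is the quotient of `M` with respect to the partition: `M S = S Q`. It is unique, as the
cells are nonempty. -/
def IsMatrixQuotient [Fintype ι] [Fintype κ] {s : κ → Set ι} (π : IndexedPartition s)
    (M : Matrix ι ι ℂ) (Q : Matrix κ κ ℂ) : Prop :=
  M * charMatrix π = charMatrix π * Q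

/-- The partition is equitable relative to `𝓑`: every `M ∈ 𝓑` has a quotient. -/
def IsEquitable [Fintype ι] [Fintype κ] {s : κ → Set ι} (π : IndexedPartition s)
    (𝓑 : Set (Matrix ι ι ℂ)) : Prop :=
  ∀ M ∈ 𝓑, ∃ Q, IsMatrixQuotient π M Q

/-- The quotient of `𝓑`: the set of the quotients of its members. -/
def quotient [Fintype ι] [Fintype κ] {s : κ → Set ι} (π : IndexedPartition s)
    (𝓑 : Set (Matrix ι ι ℂ)) : Set (Matrix κ κ ℂ) :=
  {Q | ∃ M ∈ 𝓑, IsMatrixQuotient π M Q}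

/-- The cell `{i, n + i}`; the index `i` is `Sum.inl i` and `n + i` is `Sum.inr i`. -/
def pairCell (i : ι) : Set (ι ⊕ ι) :=
  {Sum.inl i, Sum.inr i}

/-- The partition of the `2n` indices into the cells `{i, n + i}`. -/
def pairPartition (ι : Type*) : IndexedPartition (pairCell (ι := ι)) where
  eq_of_mem := by
    rintro (x | x) i j hi hj <;> simp_all [pairCell]
  some := Sum.inl
  some_mem i := by simp [pairCell]
  index := Sum.elim id id
  mem_index := by
    rintro (x | x) <;> simp [pairCell]

end JonesPair

/-!
With `S` the characteristic matrix of `π`, the vectors defining `N_{Wᵀ}` are of two kinds. The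
symmetric ones are `S (A e_i ∘ A⁽⁻⁾ e_j)` and `S (B e_j ∘ B⁽⁻⁾ e_i)`; the antisymmetric ones
`(v, -v)` are killed by `Sᵀ`. If `M ∈ N_{Wᵀ}`, then `M S` maps each `A e_i ∘ A⁽⁻⁾ e_j` to a multiple
of `S (A e_i ∘ A⁽⁻⁾ e_j)`; since these vectors span, `M S = S Q` with `Q ∈ N_A`. Conversely
`S N Sᵀ / 2` lies in `N_{Wᵀ}` and has quotient `N` as soon as `N ∈ N_A ∩ N_B`, so it remains to see
that `N_A ⊆ N_B`.

Write `Θ_C(M)` for the matrix of eigenvalues of `M ∈ N_C`. Both `A` and `B` are type II, and for a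
type II matrix `C` one has the duality `Θ_{Cᵀ}(Θ_C(M)ᵀ) = n M`. Summing the braid relation shows
that `B` maps `Bᵀ e_l ∘ (Bᵀ)⁽⁻⁾ e_m` to a multiple of `Aᵀ e_m ∘ (Aᵀ)⁽⁻⁾ e_l`. Conjugation by `B`
therefore carries `N_{Aᵀ}` into `N_{Bᵀ}`, and dualizing twice gives `Θ_B(M) = B⁻¹ Θ_A(M)ᵀ B`.
-/

namespace JonesPair

open Matrix

section Partition

variable [Fintype κ] {s : κ → Set ι} {π : IndexedPartition s}

lemma charMatrix_mulVec (v : κ → ℂ) : charMatrix π *ᵥ v = v ∘ π.index := by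
  classical
  ext h
  simp [charMatrix, mulVec, dotProduct, Set.indicator, π.mem_iff_index_eq]

lemma IsMatrixQuotient.mulVec_comp_index [Fintype ι] {M : Matrix ι ι ℂ} {Q : Matrix κ κ ℂ}
    (h : IsMatrixQuotient π M Q) (v : κ → ℂ) : M *ᵥ (v ∘ π.index) = (Q *ᵥ v) ∘ π.index := by
  rw [← charMatrix_mulVec, ← charMatrix_mulVec, mulVec_mulVec, mulVec_mulVec, h]

lemma IsMatrixQuotient.mulVec_eq_smul_iff [Fintype ι] {M : Matrix ι ι ℂ} {Q : Matrix κ κ ℂ}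
    (h : IsMatrixQuotient π M Q) {v : κ → ℂ} {c : ℂ} :
    M *ᵥ (v ∘ π.index) = c • (v ∘ π.index) ↔ Q *ᵥ v = c • v := by
  have index_surjective : Function.Surjective π.index := fun k => ⟨π.some k, π.index_some k⟩
  rw [h.mulVec_comp_index]
  exact index_surjective.injective_comp_right.eq_iff (b := c • v)

lemma isMatrixQuotient_charMatrix_mul_mul [Fintype ι] [DecidableEq κ] {L : Matrix κ ι ℂ}
    (hL : L * charMatrix π = 1) (N : Matrix κ κ ℂ) :
    IsMatrixQuotient π (charMatrix π * N * L) N := by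
  rw [IsMatrixQuotient, Matrix.mul_assoc, hL, Matrix.mul_one]

end Partition

section NomuraVec

/-- The vector `C e_i ∘ C⁽⁻⁾ e_j`: the members of the Nomura algebra `N_C` are the matrices
having all of these vectors as eigenvectors. -/
noncomputable def nomuraVec (C : Matrix ι κ ℂ) (i j : κ) : ι → ℂ :=
  C.col i * (schurInv C).col j

lemma nomuraVec_apply (C : Matrix ι κ ℂ) (i j : κ) (k : ι) :
    nomuraVec C i j k = C k i * (C k j)⁻¹ :=
  rfl

variable [Fintype ι]

lemma mulVec_nomuraVec [DecidableEq ι] {τ : Type*} (M : Matrix τ ι ℂ) (C : Matrix ι κ ℂ)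
    (i j : κ) : M *ᵥ nomuraVec C i j = (M * diagonal ((schurInv C).col j) * C).col i := by
  ext l
  rw [col_apply, mul_apply]
  simp only [mul_diagonal, mulVec, dotProduct, nomuraVec, Pi.mul_apply, col_apply, mul_assoc,
    mul_comm (C _ i)]

lemma eq_of_mulVec_nomuraVec_eq {M N : Matrix κ ι ℂ} {C : Matrix ι ι ℂ} [DecidableEq ι]
    (hC : IsUnit C) (hS : IsSchurInvertible C)
    (h : ∀ i j, M *ᵥ nomuraVec C i j = N *ᵥ nomuraVec C i j) : M = N := by
  ext l m
  simp only [mulVec_nomuraVec] at h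
  have hD : M * diagonal ((schurInv C).col m) = N * diagonal ((schurInv C).col m) := by
    have := hC.invertible
    exact mul_left_injective_of_invertible C (ext_col fun i => h i m)
  simpa [schurInv, hS m m] using congrFun₂ hD l m

variable [Fintype κ] {s : κ → Set ι} {π : IndexedPartition s}
  {U : Matrix ι ι ℂ} {C : Matrix κ κ ℂ}

lemma isEquitable_nomura [DecidableEq κ] (hC : IsUnit C) (hS : IsSchurInvertible C)
    (hU : ∀ i j, ∃ p q, nomuraVec U p q = nomuraVec C i j ∘ π.index) :
    IsEquitable π (nomura U) := by
  intro M hM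
  refine ⟨(M * charMatrix π).submatrix π.some id, eq_of_mulVec_nomuraVec_eq hC hS fun i j => ?_⟩
  obtain ⟨p, q, hpq⟩ := hU i j
  obtain ⟨c, hc⟩ : ∃ c : ℂ, M *ᵥ nomuraVec U p q = c • nomuraVec U p q := hM p q
  have hv : (M * charMatrix π) *ᵥ nomuraVec C i j = (c • nomuraVec C i j) ∘ π.index := by
    rw [← mulVec_mulVec, charMatrix_mulVec, ← hpq, hc, hpq, Pi.smul_comp]
  have hQ : (M * charMatrix π).submatrix π.some id *ᵥ nomuraVec C i j = c • nomuraVec C i j := by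
    ext k
    change ((M * charMatrix π) *ᵥ nomuraVec C i j) (π.some k) = _
    rw [hv, Function.comp_apply, π.index_some]
  rw [hv, ← mulVec_mulVec, hQ, charMatrix_mulVec]

lemma quotient_nomura_subset (hU : ∀ i j, ∃ p q, nomuraVec U p q = nomuraVec C i j ∘ π.index) :
    quotient π (nomura U) ⊆ nomura C := by
  rintro Q ⟨M, hM, hQ⟩ i j
  obtain ⟨p, q, hpq⟩ := hU i j
  obtain ⟨c, hc⟩ : ∃ c : ℂ, M *ᵥ nomuraVec U p q = c • nomuraVec U p q := hM p q
  rw [hpq] at hc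
  exact ⟨c, hQ.mulVec_eq_smul_iff.1 hc⟩

end NomuraVec

section MatW

lemma comp_pairPartition_index (v : ι → ℂ) : v ∘ (pairPartition ι).index = Sum.elim v v := by
  ext (k | k) <;> rfl

lemma nomuraVec_matW_transpose_inl_inl (A B : Matrix ι ι ℂ) (i j : ι) :
    nomuraVec (matW A B)ᵀ (.inl i) (.inl j) = nomuraVec A i j ∘ (pairPartition ι).index := by
  rw [comp_pairPartition_index]
  ext (k | k) <;> simp [nomuraVec, matW, schurInv]

lemma nomuraVec_matW_transpose_inr_inr (A B : Matrix ι ι ℂ) (i j : ι) :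
    nomuraVec (matW A B)ᵀ (.inr i) (.inr j) = nomuraVec B j i ∘ (pairPartition ι).index := by
  rw [comp_pairPartition_index]
  ext (k | k) <;> simp [nomuraVec, matW, schurInv, mul_comm]

lemma nomuraVec_matW_transpose_inl_inr (A B : Matrix ι ι ℂ) (i j : ι) :
    nomuraVec (matW A B)ᵀ (.inl i) (.inr j) =
      Sum.elim (A.col i * B.col j) (-(A.col i * B.col j)) := by
  ext (k | k) <;> simp [nomuraVec, matW, schurInv]

lemma nomuraVec_matW_transpose_inr_inl (A B : Matrix ι ι ℂ) (i j : ι) :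
    nomuraVec (matW A B)ᵀ (.inr i) (.inl j) =
      Sum.elim ((schurInv B).col i * (schurInv A).col j)
        (-((schurInv B).col i * (schurInv A).col j)) := by
  ext (k | k) <;> simp [nomuraVec, matW, schurInv, inv_neg]

/-- The `n × 2n` matrix averaging a vector over the cells `{i, n + i}`, a left inverse of the
characteristic matrix. -/
noncomputable def pairMean (ι : Type*) [DecidableEq ι] : Matrix ι (ι ⊕ ι) ℂ :=
  (2⁻¹ : ℂ) • fromCols 1 1

variable [Fintype ι] [DecidableEq ι]

lemma pairMean_mulVec_sumElim (v w : ι → ℂ) :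
    pairMean ι *ᵥ Sum.elim v w = (2⁻¹ : ℂ) • (v + w) := by
  rw [pairMean, smul_mulVec, fromCols_mulVec_sumElim, one_mulVec, one_mulVec]

lemma pairMean_mul_charMatrix : pairMean ι * charMatrix (pairPartition ι) = 1 := by
  refine mulVec_injective (funext fun v => ?_)
  rw [← mulVec_mulVec, charMatrix_mulVec, comp_pairPartition_index, pairMean_mulVec_sumElim,
    ← two_smul ℂ v, inv_smul_smul₀ two_ne_zero, one_mulVec]

lemma charMatrix_mul_mul_pairMean_mem_nomura {A B N : Matrix ι ι ℂ} (hA : N ∈ nomura A)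
    (hB : N ∈ nomura B) :
    charMatrix (pairPartition ι) * N * pairMean ι ∈ nomura (matW A B)ᵀ := by
  have hN := isMatrixQuotient_charMatrix_mul_mul (pairMean_mul_charMatrix (ι := ι)) N
  have antisymm_mem_ker (v : ι → ℂ) : (charMatrix (pairPartition ι) * N * pairMean ι) *ᵥ
      Sum.elim v (-v) = (0 : ℂ) • Sum.elim v (-v) := by
    rw [← mulVec_mulVec, pairMean_mulVec_sumElim, add_neg_cancel, smul_zero, mulVec_zero,
      zero_smul]
  change ∀ p q, ∃ c : ℂ, _ *ᵥ nomuraVec (matW A B)ᵀ p q = c • nomuraVec (matW A B)ᵀ p q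
  rintro (i | i) (j | j)
  · rw [nomuraVec_matW_transpose_inl_inl]
    exact (hA i j).imp fun _ => hN.mulVec_eq_smul_iff.2
  · rw [nomuraVec_matW_transpose_inl_inr]
    exact ⟨0, antisymm_mem_ker _⟩
  · rw [nomuraVec_matW_transpose_inr_inl]
    exact ⟨0, antisymm_mem_ker _⟩
  · rw [nomuraVec_matW_transpose_inr_inr]
    exact (hB j i).imp fun _ => hN.mulVec_eq_smul_iff.2

end MatW

section TypeII

/-- A type II matrix: a Schur invertible `C` with `C C⁽⁻⁾ᵀ = n I`. -/
structure IsTypeII [Fintype ι] [DecidableEq ι] (C : Matrix ι ι ℂ) : Prop where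
  isSchurInvertible : IsSchurInvertible C
  mul_transpose_schurInv : C * (schurInv C)ᵀ = (Fintype.card ι : ℂ) • 1

/-- `Θ` is the matrix of eigenvalues of `M ∈ N_C`, often written `Θ_C(M)`: its `(i, j)` entry is
the eigenvalue of `M` on `C e_i ∘ C⁽⁻⁾ e_j`. It is a relation, so that no eigenvalues need to be
chosen. -/
def IsNomuraTransform [Fintype ι] (C : Matrix ι κ ℂ) (M : Matrix ι ι ℂ) (Θ : Matrix κ κ ℂ) :
    Prop :=
  ∀ i j, M *ᵥ nomuraVec C i j = Θ i j • nomuraVec C i j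

variable [Fintype ι]

lemma mem_nomura_iff_exists_isNomuraTransform {C M : Matrix ι ι ℂ} :
    M ∈ nomura C ↔ ∃ Θ, IsNomuraTransform C M Θ := by
  refine ⟨fun h => ?_, fun ⟨Θ, hΘ⟩ i j => ⟨Θ i j, hΘ i j⟩⟩
  choose Θ hΘ using h
  exact ⟨Θ, hΘ⟩

variable [DecidableEq ι] {C M Θ : Matrix ι ι ℂ}

lemma IsTypeII.transpose (hC : IsTypeII C) : IsTypeII Cᵀ where
  isSchurInvertible i j := hC.isSchurInvertible j i
  mul_transpose_schurInv := by
    rcases isEmpty_or_nonempty ι with _ | _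
    · exact Subsingleton.elim _ _
    have hn : (Fintype.card ι : ℂ) ≠ 0 := Nat.cast_ne_zero.2 Fintype.card_ne_zero
    have right_inv : C * ((Fintype.card ι : ℂ)⁻¹ • (schurInv C)ᵀ) = 1 := by
      rw [Matrix.mul_smul, hC.mul_transpose_schurInv, inv_smul_smul₀ hn]
    have left_inv : (schurInv C)ᵀ * C = (Fintype.card ι : ℂ) • 1 := by
      rw [← inv_smul_eq_iff₀ hn, ← Matrix.smul_mul, mul_eq_one_comm.1 right_inv]
    rw [show schurInv Cᵀ = (schurInv C)ᵀ from rfl, ← transpose_mul, left_inv, transpose_smul,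
      transpose_one]

theorem IsNomuraTransform.transpose (hC : IsTypeII C) (h : IsNomuraTransform C M Θ) :
    IsNomuraTransform Cᵀ Θᵀ ((Fintype.card ι : ℂ) • M) := by
  intro l m
  ext j
  set D := diagonal ((schurInv C).col j)
  have hΘ : M * D * C = D * C * diagonal (Θ.col j) := ext_col fun i => by
    rw [← mulVec_nomuraVec, h i j]
    ext k
    simp only [D, mul_diagonal, diagonal_mul, nomuraVec, schurInv, col_apply, of_apply,
      Pi.smul_apply, Pi.mul_apply, smul_eq_mul]
    ring
  have hM : D * C * diagonal (Θ.col j) * (schurInv C)ᵀ = (Fintype.card ι : ℂ) • (M * D) := by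
    rw [← hΘ, Matrix.mul_assoc, hC.mul_transpose_schurInv, Matrix.mul_smul, Matrix.mul_one]
  calc (Θᵀ *ᵥ nomuraVec Cᵀ l m) j
      = C l j * (D * C * diagonal (Θ.col j) * (schurInv C)ᵀ) l m := by
        have hne := hC.isSchurInvertible l j
        rw [mul_apply, Finset.mul_sum]
        refine Finset.sum_congr rfl fun i _ => ?_
        simp only [D, mul_diagonal, diagonal_mul, nomuraVec_apply, schurInv, col_apply,
          transpose_apply, of_apply]
        field_simp
    _ = (((Fintype.card ι : ℂ) • M) l m • nomuraVec Cᵀ l m) j := by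
        rw [hM]
        simp only [D, mul_diagonal, nomuraVec_apply, schurInv, col_apply, transpose_apply, of_apply,
          Matrix.smul_apply, Pi.smul_apply, smul_eq_mul]
        ring

lemma IsNomuraTransform.of_transpose (hC : IsTypeII C)
    (h : IsNomuraTransform Cᵀ Θ ((Fintype.card ι : ℂ) • M)) : IsNomuraTransform C Mᵀ Θ := by
  intro i j
  have hn : (Fintype.card ι : ℂ) ≠ 0 := Nat.cast_ne_zero.2 (Fintype.card_pos_iff.2 ⟨i⟩).ne'
  refine smul_right_injective _ hn ?_
  simpa [smul_mulVec, smul_smul] using h.transpose hC.transpose i j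

end TypeII

section Invertible

lemma isSchurInvertible_of_isUnit_Δ {B : Matrix ι ι ℂ} (h : IsUnit (Δ B)) :
    IsSchurInvertible B := by
  intro i j hij
  obtain ⟨M, hM⟩ := ((Module.End.isUnit_iff _).1 h).surjective (of 1)
  simpa [Δ, hij] using congrFun₂ hM i j

variable [Fintype ι] [DecidableEq ι] {A : Matrix ι ι ℂ}

lemma isUnit_of_isUnit_X (h : IsUnit (X A)) : IsUnit A := by
  obtain ⟨M, hM⟩ := ((Module.End.isUnit_iff _).1 h).surjective 1
  exact IsUnit.of_mul_eq_one M hM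

lemma hadamard_inv_transpose_mulVec_one (hA : IsUnit A) : (A ⊙ A⁻¹ᵀ) *ᵥ 1 = 1 := by
  ext l
  simpa [mul_apply, mulVec, dotProduct] using
    congrFun₂ (mul_nonsing_inv A ((isUnit_iff_isUnit_det A).1 hA)) l l

lemma one_vecMul_hadamard_inv_transpose (hA : IsUnit A) : 1 ᵥ* (A ⊙ A⁻¹ᵀ) = 1 := by
  ext k
  simpa [mul_apply, vecMul, dotProduct, mul_comm] using
    congrFun₂ (nonsing_inv_mul A ((isUnit_iff_isUnit_det A).1 hA)) k k

end Invertible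

namespace IsOneSidedJonesPair

variable [Fintype ι] [DecidableEq ι] {A B : Matrix ι ι ℂ}

lemma isUnit (h : IsOneSidedJonesPair A B) : IsUnit A :=
  isUnit_of_isUnit_X h.isUnit_X

lemma isSchurInvertible (h : IsOneSidedJonesPair A B) : IsSchurInvertible B :=
  isSchurInvertible_of_isUnit_Δ h.isUnit_Δ

lemma mul_diagonal_mul (h : IsOneSidedJonesPair A B) (j : ι) :
    A * diagonal (B.col j) * A = diagonal (B.col j) * A * diagonal (B.col j) := by
  ext l i
  have := congrFun₂ (LinearMap.congr_fun h.braid (Matrix.single i j 1)) l j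
  simp only [X, Δ, Module.End.mul_apply, LinearMap.mulLeft_apply, LinearMap.coe_mk,
    AddHom.coe_mk, mul_apply, hadamard_apply, single_apply] at this
  simpa [mul_apply, diagonal_apply, ite_and, mul_assoc, mul_comm, mul_left_comm] using this

lemma mul_diagonal_mul_inv (h : IsOneSidedJonesPair A B) (j : ι) :
    A * diagonal (B.col j) * A⁻¹ =
      diagonal ((schurInv B).col j) * A * diagonal (B.col j) := by
  set D := diagonal (B.col j)
  set E := diagonal ((schurInv B).col j)
  have hED : E * D = 1 := by
    simp [E, D, schurInv, diagonal_mul_diagonal, h.isSchurInvertible _ j]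
  have hA := (isUnit_iff_isUnit_det A).1 h.isUnit
  calc A * D * A⁻¹ = E * (D * A * D) * A⁻¹ := by
        simp only [← Matrix.mul_assoc, hED, Matrix.one_mul]
    _ = E * A * D * A * A⁻¹ := by
        rw [← h.mul_diagonal_mul]
        simp only [Matrix.mul_assoc, D]
    _ = E * A * D := by rw [mul_nonsing_inv_cancel_right _ _ hA]

lemma sum_mul_mul_inv (h : IsOneSidedJonesPair A B) (l m j : ι) :
    ∑ k, A l k * A⁻¹ k m * B k j = A l m * B m j * (B l j)⁻¹ := by
  have := congrFun₂ (h.mul_diagonal_mul_inv j) l m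
  rw [mul_apply] at this
  simp only [mul_diagonal, diagonal_mul, schurInv, col_apply, of_apply] at this
  simpa only [mul_right_comm, mul_comm (B l j)⁻¹] using this

lemma hadamard_inv_transpose_mul (h : IsOneSidedJonesPair A B) :
    (A ⊙ A⁻¹ᵀ) * B = vecMulVec A.diag 1 := by
  ext l j
  simpa [mul_apply, vecMulVec_apply, mul_assoc, h.isSchurInvertible l j] using
    h.sum_mul_mul_inv l l j

lemma one_vecMul (h : IsOneSidedJonesPair A B) : 1 ᵥ* B = A.trace • 1 := by
  conv_lhs => rw [← one_vecMul_hadamard_inv_transpose h.isUnit, vecMul_vecMul,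
    h.hadamard_inv_transpose_mul, vecMul_vecMulVec]
  rw [one_dotProduct]
  rfl

lemma trace_ne_zero [Nonempty ι] (h : IsOneSidedJonesPair A B) (hB : IsUnit B) :
    A.trace ≠ 0 := by
  intro h0
  refine one_ne_zero (vecMul_injective_of_isUnit hB ?_ : (1 : ι → ℂ) = 0)
  simp only [h.one_vecMul, h0, zero_smul, zero_vecMul]

lemma transpose_schurInv (h : IsOneSidedJonesPair A B) (hB : IsUnit B) :
    (schurInv A)ᵀ = (Fintype.card ι : ℂ) • A⁻¹ := by
  have hrow : A.trace • (A ⊙ A⁻¹ᵀ) = vecMulVec A.diag 1 := by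
    have := hB.invertible
    refine mul_left_injective_of_invertible B ?_
    change A.trace • (A ⊙ A⁻¹ᵀ) * B = vecMulVec A.diag 1 * B
    rw [Matrix.smul_mul, h.hadamard_inv_transpose_mul, vecMulVec_mul, h.one_vecMul,
      vecMulVec_smul]
  have hdiag : A.trace • 1 = (Fintype.card ι : ℂ) • A.diag := by
    have := congrArg (· *ᵥ (1 : ι → ℂ)) hrow
    simpa only [smul_mulVec, hadamard_inv_transpose_mulVec_one h.isUnit, vecMulVec_mulVec,
      one_dotProduct_one, op_smul_eq_smul] using this
  ext k l
  have : Nonempty ι := ⟨l⟩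
  have entry : A l k * (Fintype.card ι * A⁻¹ k l) = 1 := by
    refine mul_left_cancel₀ (h.trace_ne_zero hB) ?_
    have diag_eq : A.trace * (A l k * A⁻¹ k l) = A l l := by
      simpa [vecMulVec_apply] using congrFun₂ hrow l k
    have trace_eq : A.trace = Fintype.card ι * A l l := by simpa using congrFun hdiag l
    linear_combination (Fintype.card ι : ℂ) * diag_eq - trace_eq
  exact inv_eq_of_mul_eq_one_right entry

lemma mulVec_nomuraVec_transpose (h : IsOneSidedJonesPair A B) (hA : IsSchurInvertible A)
    (hB : IsTypeII B) (l m : ι) :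
    B *ᵥ nomuraVec Bᵀ l m = (Fintype.card ι * A l m) • nomuraVec Aᵀ m l := by
  ext i
  refine mul_left_cancel₀ (hA l i) ?_
  have hsum (j : ι) : B l j * A l i * B i j = ∑ k, A l k * A k i * B k j := by
    simpa [mul_apply, diagonal_apply, mul_right_comm] using
      (congrFun₂ (h.mul_diagonal_mul j) l i).symm
  calc A l i * (B *ᵥ nomuraVec Bᵀ l m) i
      = ∑ j, (∑ k, A l k * A k i * B k j) * (B m j)⁻¹ := by
        simp only [mulVec, dotProduct, nomuraVec_apply, transpose_apply, Finset.mul_sum, ← hsum]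
        exact Finset.sum_congr rfl fun j _ => by ring
    _ = ∑ k, A l k * A k i * (B * (schurInv B)ᵀ) k m := by
        simp only [mul_apply, schurInv, transpose_apply, of_apply, Finset.sum_mul, Finset.mul_sum,
          ← mul_assoc]
        exact Finset.sum_comm
    _ = A l i * ((Fintype.card ι * A l m) • nomuraVec Aᵀ m l) i := by
        have := hA l i
        simp only [hB.mul_transpose_schurInv, Matrix.smul_apply, one_apply, smul_eq_mul, mul_ite,
          mul_one, mul_zero, Finset.sum_ite_eq', Finset.mem_univ, if_true, Pi.smul_apply,
          nomuraVec_apply, transpose_apply]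
        field_simp

end IsOneSidedJonesPair

namespace IsInvertibleJonesPair

variable [Fintype ι] [DecidableEq ι] {A B : Matrix ι ι ℂ}

lemma isTypeII_left (h : IsInvertibleJonesPair A B) : IsTypeII A where
  isSchurInvertible := h.isSchurInvertible
  mul_transpose_schurInv := by
    have hA := (isUnit_iff_isUnit_det A).1 h.isJonesPair.left.isUnit
    rw [h.isJonesPair.left.transpose_schurInv h.isUnit, Matrix.mul_smul, mul_nonsing_inv A hA]

lemma isTypeII_right (h : IsInvertibleJonesPair A B) : IsTypeII B where
  isSchurInvertible := h.isJonesPair.left.isSchurInvertible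
  mul_transpose_schurInv := by
    have hB := h.isJonesPair.left.isSchurInvertible
    have hA := (isUnit_iff_isUnit_det A).1 h.isJonesPair.left.isUnit
    have row_sum (k : ι) : ∑ j, B k j = A.trace := by
      simpa [vecMul, dotProduct] using congrFun h.isJonesPair.right.one_vecMul k
    ext m l
    obtain rfl | hml := eq_or_ne m l
    · simp [mul_apply, schurInv, hB m _]
    suffices A l m * (B * (schurInv B)ᵀ) m l = 0 by
      simpa [hml, h.isSchurInvertible l m] using this
    calc A l m * (B * (schurInv B)ᵀ) m l
        = ∑ j, ∑ k, A l k * A⁻¹ k m * B k j := by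
          simp only [h.isJonesPair.left.sum_mul_mul_inv]
          simp only [mul_apply, schurInv, transpose_apply, of_apply, Finset.mul_sum, mul_assoc]
      _ = (A * A⁻¹) l m * A.trace := by
          rw [Finset.sum_comm]
          simp only [← Finset.mul_sum, row_sum, ← Finset.sum_mul, mul_apply]
      _ = 0 := by rw [mul_nonsing_inv A hA, one_apply_ne hml.symm, zero_mul]

theorem isNomuraTransform (h : IsInvertibleJonesPair A B) {M Θ : Matrix ι ι ℂ}
    (hM : IsNomuraTransform A M Θ) : IsNomuraTransform B M (B⁻¹ * Θᵀ * B) := by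
  have hB := (isUnit_iff_isUnit_det B).1 h.isUnit
  refine IsNomuraTransform.of_transpose (M := Mᵀ) h.isTypeII_right fun l m => ?_
  have hBv := h.isJonesPair.left.mulVec_nomuraVec_transpose h.isSchurInvertible h.isTypeII_right l m
  have hΘ := hM.transpose h.isTypeII_left m l
  rw [← mulVec_mulVec, hBv, ← mulVec_mulVec, mulVec_smul, hΘ, smul_comm, ← hBv, mulVec_smul,
    mulVec_mulVec, nonsing_inv_mul B hB, one_mulVec]
  rfl

lemma nomura_subset (h : IsInvertibleJonesPair A B) : nomura A ⊆ nomura B := fun M hM => by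
  obtain ⟨Θ, hΘ⟩ := mem_nomura_iff_exists_isNomuraTransform.1 hM
  exact mem_nomura_iff_exists_isNomuraTransform.2 ⟨_, h.isNomuraTransform hΘ⟩

end IsInvertibleJonesPair

end JonesPair

open JonesPair in
theorem mainTheorem6_general {ι : Type*} [Fintype ι] [DecidableEq ι] {A B : Matrix ι ι ℂ}
    (hAB : IsInvertibleJonesPair A B) :
    IsEquitable (pairPartition ι) (nomura (matW A B)ᵀ) ∧
      quotient (pairPartition ι) (nomura (matW A B)ᵀ) = nomura A := by
  have hW (i j : ι) : ∃ p q, nomuraVec (matW A B)ᵀ p q =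
      nomuraVec A i j ∘ (pairPartition ι).index :=
    ⟨.inl i, .inl j, nomuraVec_matW_transpose_inl_inl A B i j⟩
  refine ⟨isEquitable_nomura hAB.isJonesPair.left.isUnit hAB.isSchurInvertible hW,
    (quotient_nomura_subset hW).antisymm fun N hN => ?_⟩
  exact ⟨_, charMatrix_mul_mul_pairMean_mem_nomura hN (hAB.nomura_subset hN),
    isMatrixQuotient_charMatrix_mul_mul pairMean_mul_charMatrix N⟩

theorem mainTheorem6 (n : ℕ) (A B : Matrix (Fin n) (Fin n) ℂ)
    (hAB : JonesPair.IsInvertibleJonesPair A B) (hA : A.IsSymm) :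
    JonesPair.IsEquitable (JonesPair.pairPartition (Fin n))
        (JonesPair.nomura (JonesPair.matW A B)ᵀ) ∧
      JonesPair.quotient (JonesPair.pairPartition (Fin n))
        (JonesPair.nomura (JonesPair.matW A B)ᵀ) = JonesPair.nomura A :=
  mainTheorem6_general hAB
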